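/- Let $H_0=1$, $H_1(x)=2x$, $H_{n+2}(x)=2xH_{n+1}(x)-2(n+1)H_n(x)$ be the Hermite polynomials, and let $\psi_n(x)=(2^n n!\sqrt{\pi})^{-1/2}H_n(x)e^{-x^2/2}$ be the wave function of the Fock state $|n\rangle$ of a qumode. Ideal states of one (two) qumodes are tempered distributions on $\mathbb{R}$ (on $\mathbb{R}^2$), in position representation. The ideal GKP code is the span of $$|0_L\rangle=\sum_{k\in\mathbb{Z}}\delta(x-2k\sqrt{\pi}),\qquad |1_L\rangle=\sum_{k\in\mathbb{Z}}\delta(x-(2k+1)\sqrt{\pi}).$$ The Fourier gate $F$ is the unitary Fourier transform $(F\varphi)(p)=(2\pi)^{-1/2}\int_{\mathbb{R}} e^{-ixp}\varphi(x)\,dx$, extended to tempered distributions by $(FT)(\varphi)=T(F\varphi)$. The first qumode of the entangled pair $|0_L\rangle|0_L\rangle+|1_L\rangle|1_L\rangle$ is destructively measured in the Fock basis; given that the outcome $n\in\mathbb{N}$ is observed, the second qumode is left in the (unnormalised) state $$s_n=\langle n|0_L\rangle\,|0_L\rangle+\langle n|1_L\rangle\,|1_L\rangle,\qquad \langle n|b_L\rangle=\sum_{k\in\mathbb{Z}}\psi_n\big((2k+b)\sqrt{\pi}\big).$$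 **Proposition.** Let $n$ be even, and suppose that the outcome $n$ can occur, i.e. $s_n\neq 0$. Then $s_n$ is a GKP eigenstate of the Hadamard gate, with eigenvalue $c=1$ if $n\equiv 0 \pmod 4$ and $c=-1$ if $n\equiv 2\pmod 4$. That is, $s_n$ is a nonzero element $v_0|0_L\rangle+v_1|1_L\rangle$ of the GKP code, its logical qubit state satisfies $Hv=c\,v$ for the qubit Hadamard gate $H=\frac{1}{\sqrt2}\begin{pmatrix}1&1\\1&-1\end{pmatrix}$, and $F s_n=c\,s_n$. -/

import Mathlib

open MeasureTheory
open scoped SchwartzMap FourierTransform ContDiff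

namespace GKP

/-! ### Fock states -/

/-- The physicists' Hermite polynomials `H₀ = 1`, `H₁ = 2x`,
`Hₙ₊₂ = 2x Hₙ₊₁ - 2(n+1) Hₙ`. -/
noncomputable def hermitePoly : ℕ → Polynomial ℝ
  | 0 => 1
  | 1 => 2 * Polynomial.X
  | n + 2 => 2 * Polynomial.X * hermitePoly (n + 1) - 2 * ((n : Polynomial ℝ) + 1) * hermitePoly n

/-- The Hermite functions `ψₙ(x) = (2ⁿ n! √π)^(-1/2) Hₙ(x) e^(-x²/2)`. -/
noncomputable def hermiteFun (n : ℕ) (x : ℝ) : ℝ :=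
  (Real.sqrt (2 ^ n * n.factorial * Real.sqrt Real.pi))⁻¹ * (hermitePoly n).eval x *
    Real.exp (-(x ^ 2 / 2))

theorem contDiff_hermiteFun (n : ℕ) : ContDiff ℝ ∞ (hermiteFun n) := by
  unfold hermiteFun
  have : ContDiff ℝ ∞ (fun x : ℝ => (hermitePoly n).eval x) := by
    simpa using (hermitePoly n).contDiff_aeval (𝕜 := ℝ) (n := ∞)
  fun_prop

/-- A polynomial times the Gaussian is bounded. -/
theorem bounded_poly_mul_gaussian (p : Polynomial ℝ) :
    ∃ C : ℝ, ∀ x : ℝ, |p.eval x * Real.exp (-(x ^ 2 / 2))| ≤ C := by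
  induction p using Polynomial.induction_on' with
  | add p q hp hq =>
    obtain ⟨C, hC⟩ := hp
    obtain ⟨D, hD⟩ := hq
    refine ⟨C + D, fun x => ?_⟩
    rw [Polynomial.eval_add, add_mul]
    exact (abs_add_le _ _).trans (add_le_add (hC x) (hD x))
  | monomial n a =>
    refine ⟨|a| * (2 ^ n * n.factorial + 1), fun x => ?_⟩
    rw [Polynomial.eval_monomial, mul_assoc, abs_mul]
    refine mul_le_mul_of_nonneg_left ?_ (abs_nonneg a)
    rw [abs_mul, abs_pow, Real.abs_exp]
    rw [Real.exp_neg, ← div_eq_mul_inv, div_le_iff₀ (Real.exp_pos _)]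
    by_cases hx : |x| ≤ 1
    · have h1 : |x| ^ n ≤ 1 := pow_le_one₀ (abs_nonneg x) hx
      have h2 : (1 : ℝ) ≤ Real.exp (x ^ 2 / 2) := Real.one_le_exp (by positivity)
      have h3 : (0 : ℝ) ≤ 2 ^ n * n.factorial := by positivity
      nlinarith
    · have hx' : 1 ≤ |x| := (not_le.mp hx).le
      have h1 : (x ^ 2 / 2) ^ n / n.factorial ≤ Real.exp (x ^ 2 / 2) :=
        Real.pow_div_factorial_le_exp _ (by positivity) n
      have h2 : |x| ^ n ≤ (x ^ 2) ^ n := by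
        refine pow_le_pow_left₀ (abs_nonneg x) ?_ n
        rw [← sq_abs]
        nlinarith
      have h3 : (0 : ℝ) < n.factorial := by positivity
      rw [div_pow, div_div, div_le_iff₀ (by positivity)] at h1
      have h4 := Real.exp_pos (x ^ 2 / 2)
      nlinarith

theorem iteratedDeriv_poly_mul_gaussian (n : ℕ) (p : Polynomial ℝ) :
    ∃ q : Polynomial ℝ, iteratedDeriv n (fun x : ℝ => p.eval x * Real.exp (-(x ^ 2 / 2))) =
      fun x => q.eval x * Real.exp (-(x ^ 2 / 2)) := by
  induction n with
  | zero => exact ⟨p, by simp⟩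
  | succ n ih =>
    obtain ⟨q, hq⟩ := ih
    refine ⟨Polynomial.derivative q - Polynomial.X * q, ?_⟩
    rw [iteratedDeriv_succ, hq]
    funext x
    have h1 : HasDerivAt (fun x : ℝ => Real.exp (-(x ^ 2 / 2)))
        (Real.exp (-(x ^ 2 / 2)) * (-x)) x := by
      have h2 : HasDerivAt (fun x : ℝ => -(x ^ 2 / 2)) (-x) x := by
        refine ((hasDerivAt_pow 2 x).div_const 2).neg.congr_deriv ?_
        simp
      exact h2.exp
    refine ((q.hasDerivAt x).mul h1).deriv.trans ?_
    simp only [Polynomial.eval_sub, Polynomial.eval_mul, Polynomial.eval_X]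
    ring

theorem hermiteFun_decay (n k m : ℕ) :
    ∃ C : ℝ, ∀ x : ℝ, ‖x‖ ^ k * ‖iteratedFDeriv ℝ m (hermiteFun n) x‖ ≤ C := by
  set c := (Real.sqrt (2 ^ n * n.factorial * Real.sqrt Real.pi))⁻¹
  have h0 : hermiteFun n =
      fun x => (Polynomial.C c * hermitePoly n).eval x * Real.exp (-(x ^ 2 / 2)) := by
    funext x
    simp [hermiteFun, c]
  obtain ⟨q, hq⟩ := iteratedDeriv_poly_mul_gaussian m (Polynomial.C c * hermitePoly n)
  obtain ⟨C, hC⟩ := bounded_poly_mul_gaussian (Polynomial.X ^ k * q)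
  refine ⟨C, fun x => ?_⟩
  rw [norm_iteratedFDeriv_eq_norm_iteratedDeriv, h0, hq]
  have := hC x
  rw [Polynomial.eval_mul, Polynomial.eval_pow, Polynomial.eval_X, mul_assoc, abs_mul,
    abs_pow] at this
  simpa [Real.norm_eq_abs] using this

/-- The Fock state `|n⟩ = ∫ ψₙ(x) |x⟩ dx`, as a Schwartz wave function. -/
noncomputable def fock (n : ℕ) : 𝓢(ℝ, ℂ) :=
  SchwartzMap.postcompCLM (𝕜 := ℝ) Complex.ofRealCLM
    { toFun := hermiteFun n
      smooth' := contDiff_hermiteFun n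
      decay' := hermiteFun_decay n }

theorem fock_apply (n : ℕ) (x : ℝ) : fock n x = (hermiteFun n x : ℂ) := rfl

/-! ### The code words of the ideal GKP code

Ideal (unnormalisable) states of one and of two qumodes are tempered distributions on `ℝ` and on
`ℝ × ℝ`, in position representation: the position eigenstate `|x⟩` is the Dirac delta at `x`. -/

/-- The comb `∑ₖ δ(x - (2k + b)√π)`, for `b = 0, 1`. -/
noncomputable def comb (b : Fin 2) : Measure ℝ :=
  Measure.sum fun k : ℤ => Measure.dirac ((2 * (k : ℝ) + (b : ℕ)) * Real.sqrt Real.pi)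

theorem summable_comb (b : Fin 2) :
    Summable fun k : ℤ => (1 + ‖(2 * (k : ℝ) + (b : ℕ)) * Real.sqrt Real.pi‖) ^ (-(2 : ℝ)) := by
  have hs : Summable fun k : ℤ => 1 / |(k : ℝ)| ^ (2 : ℝ) :=
    (Real.summable_abs_int_rpow (b := 2) (by norm_num)).congr
      fun k => by rw [Real.rpow_neg (abs_nonneg _), one_div]
  refine Summable.of_norm_bounded_eventually (g := fun k : ℤ => 1 / |(k : ℝ)| ^ (2 : ℝ)) hs ?_
  refine (Set.finite_singleton (0 : ℤ)).subset fun k hk => ?_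
  by_contra hk0
  refine hk ?_
  have hk1 : (1 : ℝ) ≤ |(k : ℝ)| := by exact_mod_cast Int.one_le_abs hk0
  have hb : ((b : ℕ) : ℝ) ≤ 1 := by
    have : (b : ℕ) ≤ 1 := by omega
    exact_mod_cast this
  have hb0 : (0 : ℝ) ≤ ((b : ℕ) : ℝ) := by positivity
  have hpi : (1 : ℝ) ≤ Real.sqrt Real.pi := by
    rw [Real.one_le_sqrt]
    linarith [Real.pi_gt_three]
  have h1 : |(k : ℝ)| ≤ |2 * (k : ℝ) + (b : ℕ)| := by
    have h2 : |2 * (k : ℝ)| ≤ |2 * (k : ℝ) + (b : ℕ)| + |((b : ℕ) : ℝ)| := by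
      have := abs_sub (2 * (k : ℝ) + (b : ℕ)) ((b : ℕ) : ℝ)
      simpa using this
    rw [abs_mul, abs_two, abs_of_nonneg hb0] at h2
    linarith
  have h3 : |(k : ℝ)| ≤ 1 + ‖(2 * (k : ℝ) + (b : ℕ)) * Real.sqrt Real.pi‖ := by
    rw [Real.norm_eq_abs, abs_mul, abs_of_nonneg (Real.sqrt_nonneg _)]
    nlinarith [abs_nonneg (2 * (k : ℝ) + (b : ℕ))]
  change ‖(1 + ‖(2 * (k : ℝ) + (b : ℕ)) * Real.sqrt Real.pi‖) ^ (-(2 : ℝ))‖ ≤ _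
  rw [Real.norm_of_nonneg (by positivity), Real.rpow_neg (by positivity), ← one_div]
  exact one_div_le_one_div_of_le (by positivity)
    (Real.rpow_le_rpow (abs_nonneg _) h3 (by norm_num))

theorem integrable_comb (b : Fin 2) :
    Integrable (fun x : ℝ => (1 + ‖x‖) ^ (-(2 : ℝ))) (comb b) := by
  have h := (integrable_sum_dirac_iff (c := fun _ : ℤ => (1 : ENNReal))
    (x := fun k : ℤ => (2 * (k : ℝ) + (b : ℕ)) * Real.sqrt Real.pi)
    (f := fun x : ℝ => (1 + ‖x‖) ^ (-(2 : ℝ))) (by simp)).2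
    (by simpa using (summable_comb b).norm)
  simpa [comb] using h

instance instTemperateComb (b : Fin 2) : (comb b).HasTemperateGrowth :=
  ⟨2, by simpa using integrable_comb b⟩

instance instSFiniteComb (b : Fin 2) : SFinite (comb b) := by
  unfold comb
  infer_instance

instance instTemperateProdComb (b c : Fin 2) : ((comb b).prod (comb c)).HasTemperateGrowth := by
  refine ⟨4, ((integrable_comb b).mul_prod (integrable_comb c)).mono' ?_ ?_⟩
  · refine Measurable.aestronglyMeasurable ?_
    fun_prop
  · refine Filter.Eventually.of_forall fun z => ?_
    have h1 : ‖z.1‖ ≤ ‖z‖ := norm_fst_le z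
    have h2 : ‖z.2‖ ≤ ‖z‖ := norm_snd_le z
    have e : (1 + ‖z‖) ^ (-((4 : ℕ) : ℝ)) = (1 + ‖z‖) ^ (-(2 : ℝ)) * (1 + ‖z‖) ^ (-(2 : ℝ)) := by
      rw [← Real.rpow_add (by positivity)]
      norm_num
    rw [Real.norm_of_nonneg (by positivity), e]
    exact mul_le_mul
      (Real.rpow_le_rpow_of_nonpos (by positivity) (by linarith) (by norm_num))
      (Real.rpow_le_rpow_of_nonpos (by positivity) (by linarith) (by norm_num))
      (by positivity) (by positivity)

/-- The logical basis states `|0_L⟩ = ∑ₖ |2k√π⟩` and `|1_L⟩ = ∑ₖ |(2k+1)√π⟩`. -/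
noncomputable def logicalKet (b : Fin 2) : 𝓢'(ℝ, ℂ) :=
  (comb b).toTemperedDistribution

theorem logicalKet_apply (b : Fin 2) (φ : 𝓢(ℝ, ℂ)) :
    logicalKet b φ = ∑' k : ℤ, φ ((2 * (k : ℝ) + (b : ℕ)) * Real.sqrt Real.pi) := by
  have h := integral_sum_dirac (c := fun _ : ℤ => (1 : ENNReal))
    (x := fun k : ℤ => (2 * (k : ℝ) + (b : ℕ)) * Real.sqrt Real.pi)
    (f := fun x : ℝ => φ x) (by simp)
  simpa [comb, logicalKet] using h

/-- The GKP encoder, sending the qubit state `v₀|0⟩ + v₁|1⟩` to `v₀|0_L⟩ + v₁|1_L⟩`.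
Its range is the GKP code space. -/
noncomputable def encoder : (Fin 2 → ℂ) →ₗ[ℂ] 𝓢'(ℝ, ℂ) :=
  Fintype.linearCombination ℂ logicalKet

/-- The qubit Hadamard gate. -/
noncomputable def hadamard : (Fin 2 → ℂ) →ₗ[ℂ] (Fin 2 → ℂ) :=
  Matrix.toLin' (((Real.sqrt 2 : ℝ) : ℂ)⁻¹ • !![1, 1; 1, -1])

/-! ### The Fourier gate -/

/-- The unitary Fourier transform `φ ↦ (p ↦ (2π)^(-1/2) ∫ e^(-ixp) φ(x) dx)` of Schwartz
functions. -/
noncomputable def fourierSchwartz : 𝓢(ℝ, ℂ) →L[ℂ] 𝓢(ℝ, ℂ) :=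
  ((Real.sqrt (2 * Real.pi) : ℝ) : ℂ)⁻¹ •
    (SchwartzMap.compCLMOfContinuousLinearEquiv ℂ
      (ContinuousLinearEquiv.smulLeft (Units.mk0 (2 * Real.pi)⁻¹
        (inv_ne_zero Real.two_pi_pos.ne') : ℝˣ))).comp
      (FourierTransform.fourierCLM ℂ 𝓢(ℝ, ℂ))

theorem fourierSchwartz_apply (φ : 𝓢(ℝ, ℂ)) (p : ℝ) :
    fourierSchwartz φ p = ((Real.sqrt (2 * Real.pi) : ℝ) : ℂ)⁻¹ *
      ∫ x : ℝ, Complex.exp (-Complex.I * x * p) * φ x := by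
  have hpi : (Real.pi : ℂ) ≠ 0 := by exact_mod_cast Real.pi_ne_zero
  have h : fourierSchwartz φ p = ((Real.sqrt (2 * Real.pi) : ℝ) : ℂ)⁻¹ *
      𝓕 (φ : ℝ → ℂ) ((2 * Real.pi)⁻¹ * p) := rfl
  rw [h, Real.fourier_eq']
  congr 1
  refine integral_congr_ae (Filter.Eventually.of_forall fun x => ?_)
  simp only [smul_eq_mul]
  congr 2
  simp
  field_simp

/-- The Fourier gate on ideal states: the unitary Fourier transform extended to tempered
distributions by duality. -/
noncomputable def fourierGate : 𝓢'(ℝ, ℂ) →L[ℂ] 𝓢'(ℝ, ℂ) :=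
  PointwiseConvergenceCLM.precomp ℂ fourierSchwartz

theorem fourierGate_apply (T : 𝓢'(ℝ, ℂ)) (φ : 𝓢(ℝ, ℂ)) :
    fourierGate T φ = T (fourierSchwartz φ) := rfl

/-! ### The protocol -/

/-- The product `(f ⊗ g)(x, y) = f x * g y` of Schwartz functions, continuous in `g`. -/
noncomputable def tensor (f : 𝓢(ℝ, ℂ)) : 𝓢(ℝ, ℂ) →L[ℂ] 𝓢(ℝ × ℝ, ℂ) :=
  SchwartzMap.mkCLM (fun g z => f z.1 * g z.2)
    (fun g h z => by simp [mul_add])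
    (fun a g z => by simp [mul_left_comm])
    (fun g => ((f.smooth ⊤).comp contDiff_fst).mul ((g.smooth ⊤).comp contDiff_snd)) <| by
  rintro ⟨k, m⟩
  refine ⟨Finset.Iic (k, m), ∑ i ∈ Finset.range (m + 1), (m.choose i : ℝ) *
    (SchwartzMap.seminorm ℂ k i f + SchwartzMap.seminorm ℂ 0 i f), by positivity, fun g z => ?_⟩
  have hf : ContDiff ℝ ∞ (f : ℝ → ℂ) := f.smooth ⊤
  have hg : ContDiff ℝ ∞ (g : ℝ → ℂ) := g.smooth ⊤
  have hfst : ∀ i : ℕ, ‖iteratedFDeriv ℝ i (fun z : ℝ × ℝ => f z.1) z‖ ≤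
      ‖iteratedFDeriv ℝ i f z.1‖ := by
    intro i
    have h := (ContinuousLinearMap.fst ℝ ℝ ℝ).iteratedFDeriv_comp_right hf z (i := i)
      (by exact_mod_cast le_top)
    change ‖iteratedFDeriv ℝ i (f ∘ (ContinuousLinearMap.fst ℝ ℝ ℝ)) z‖ ≤ _
    rw [h]
    refine (ContinuousMultilinearMap.norm_compContinuousLinearMap_le _ _).trans ?_
    refine mul_le_of_le_one_right (norm_nonneg _) ?_
    exact Finset.prod_le_one (fun _ _ => norm_nonneg _)
      fun _ _ => ContinuousLinearMap.norm_fst_le ℝ ℝ ℝ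
  have hsnd : ∀ i : ℕ, ‖iteratedFDeriv ℝ i (fun z : ℝ × ℝ => g z.2) z‖ ≤
      ‖iteratedFDeriv ℝ i g z.2‖ := by
    intro i
    have h := (ContinuousLinearMap.snd ℝ ℝ ℝ).iteratedFDeriv_comp_right hg z (i := i)
      (by exact_mod_cast le_top)
    change ‖iteratedFDeriv ℝ i (g ∘ (ContinuousLinearMap.snd ℝ ℝ ℝ)) z‖ ≤ _
    rw [h]
    refine (ContinuousMultilinearMap.norm_compContinuousLinearMap_le _ _).trans ?_
    refine mul_le_of_le_one_right (norm_nonneg _) ?_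
    exact Finset.prod_le_one (fun _ _ => norm_nonneg _)
      fun _ _ => ContinuousLinearMap.norm_snd_le ℝ ℝ ℝ
  set S : ℝ := (Finset.Iic (k, m)).sup (schwartzSeminormFamily ℂ ℝ ℂ) g
  have hS : ∀ j i : ℕ, j ≤ k → i ≤ m → SchwartzMap.seminorm ℂ j i g ≤ S := by
    intro j i hj hi
    have h : schwartzSeminormFamily ℂ ℝ ℂ (j, i) ≤
        (Finset.Iic (k, m)).sup (schwartzSeminormFamily ℂ ℝ ℂ) :=
      Finset.le_sup (f := schwartzSeminormFamily ℂ ℝ ℂ) (Finset.mem_Iic.2 ⟨hj, hi⟩)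
    exact h g
  have hz : ‖z‖ ^ k ≤ ‖z.1‖ ^ k + ‖z.2‖ ^ k := by
    rw [Prod.norm_def]
    rcases max_choice ‖z.1‖ ‖z.2‖ with h | h <;> rw [h]
    · exact le_add_of_nonneg_right (by positivity)
    · exact le_add_of_nonneg_left (by positivity)
  have hmul := norm_iteratedFDeriv_mul_le (𝕜 := ℝ) (hf.comp contDiff_fst) (hg.comp contDiff_snd)
    z (n := m) (by exact_mod_cast le_top)
  calc ‖z‖ ^ k * ‖iteratedFDeriv ℝ m (fun z : ℝ × ℝ => f z.1 * g z.2) z‖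
      ≤ ‖z‖ ^ k * ∑ i ∈ Finset.range (m + 1), (m.choose i : ℝ) *
          ‖iteratedFDeriv ℝ i (fun z : ℝ × ℝ => f z.1) z‖ *
          ‖iteratedFDeriv ℝ (m - i) (fun z : ℝ × ℝ => g z.2) z‖ := by
        gcongr
        exact hmul
    _ ≤ (∑ i ∈ Finset.range (m + 1), (m.choose i : ℝ) *
          (SchwartzMap.seminorm ℂ k i f + SchwartzMap.seminorm ℂ 0 i f)) * S := by
        rw [Finset.mul_sum, Finset.sum_mul]
        refine Finset.sum_le_sum fun i _ => ?_
        have f1 := SchwartzMap.le_seminorm ℂ k i f z.1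
        have f0 := SchwartzMap.norm_iteratedFDeriv_le_seminorm ℂ f i z.1
        have g1 := (SchwartzMap.le_seminorm ℂ k (m - i) g z.2).trans
          (hS k (m - i) le_rfl (Nat.sub_le _ _))
        have g0 := (SchwartzMap.norm_iteratedFDeriv_le_seminorm ℂ g (m - i) z.2).trans
          (hS 0 (m - i) (Nat.zero_le _) (Nat.sub_le _ _))
        set a := ‖iteratedFDeriv ℝ i f z.1‖
        set b := ‖iteratedFDeriv ℝ (m - i) g z.2‖
        have ha : 0 ≤ a := norm_nonneg _
        have hb : 0 ≤ b := norm_nonneg _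
        calc ‖z‖ ^ k * ((m.choose i : ℝ) *
              ‖iteratedFDeriv ℝ i (fun z : ℝ × ℝ => f z.1) z‖ *
              ‖iteratedFDeriv ℝ (m - i) (fun z : ℝ × ℝ => g z.2) z‖)
            ≤ (‖z.1‖ ^ k + ‖z.2‖ ^ k) * ((m.choose i : ℝ) * a * b) := by
              gcongr
              · exact hfst i
              · exact hsnd (m - i)
          _ = (m.choose i : ℝ) * ((‖z.1‖ ^ k * a) * b + a * (‖z.2‖ ^ k * b)) := by ring
          _ ≤ (m.choose i : ℝ) * (SchwartzMap.seminorm ℂ k i f * S +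
                SchwartzMap.seminorm ℂ 0 i f * S) := by
              gcongr
          _ = (m.choose i : ℝ) *
                (SchwartzMap.seminorm ℂ k i f + SchwartzMap.seminorm ℂ 0 i f) * S := by ring

theorem tensor_apply (f g : 𝓢(ℝ, ℂ)) (z : ℝ × ℝ) : tensor f g z = f z.1 * g z.2 := rfl

/-- The entangled state `|0_L⟩|0_L⟩ + |1_L⟩|1_L⟩` of two qumodes. -/
noncomputable def bellState : 𝓢'(ℝ × ℝ, ℂ) :=
  ∑ b : Fin 2, ((comb b).prod (comb b)).toTemperedDistribution

theorem bellState_tensor (f g : 𝓢(ℝ, ℂ)) :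
    bellState (tensor f g) = ∑ b : Fin 2, logicalKet b f * logicalKet b g := by
  have h (b : Fin 2) : ((comb b).prod (comb b)).toTemperedDistribution (tensor f g) =
      logicalKet b f * logicalKet b g := by
    simpa [tensor_apply, logicalKet] using
      integral_prod_mul (μ := comb b) (ν := comb b) (fun x => f x) (fun x => g x)
  simp only [bellState, Fin.sum_univ_two, ← h]
  rfl

/-- The partial inner product `(⟨f| ⊗ 1) T` of a two-mode state with a real wave function `f` in
the first mode. -/
noncomputable def contractFirst (f : 𝓢(ℝ, ℂ)) : 𝓢'(ℝ × ℝ, ℂ) →L[ℂ] 𝓢'(ℝ, ℂ) :=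
  PointwiseConvergenceCLM.precomp ℂ (tensor f)

theorem contractFirst_apply (f : 𝓢(ℝ, ℂ)) (T : 𝓢'(ℝ × ℝ, ℂ)) (g : 𝓢(ℝ, ℂ)) :
    contractFirst f T g = T (tensor f g) := rfl

/-- The (unnormalised) state of the second qumode after a destructive Fock measurement of the first
qumode of the entangled pair, with outcome `n`. The outcome `n` has nonzero amplitude precisely
if this state is nonzero. -/
noncomputable def distilled (n : ℕ) : 𝓢'(ℝ, ℂ) :=
  contractFirst (fock n) bellState

/-- `s` is a GKP eigenstate of the Hadamard gate with eigenvalue `c`: a nonzero state of the GKP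
code space, whose logical qubit state is an eigenvector of the qubit Hadamard gate, and which is an
eigenvector of the Fourier gate. -/
def IsHadamardEigenstate (c : ℂ) (s : 𝓢'(ℝ, ℂ)) : Prop :=
  s ≠ 0 ∧ (∃ v : Fin 2 → ℂ, encoder v = s ∧ hadamard v = c • v) ∧ fourierGate s = c • s

end GKP

namespace GKP

/-! ### Poisson summation for the code words -/

/-! Two facts about the Fourier transform meet. Poisson summation (`logicalKet_eq_fourierSchwartz`)
writes each code word as a Hadamard combination of the Fourier transforms of the two code words;
since H is an involution, F acts on the code exactly as the logical H (`fourierGate_encoder`). On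
the other side, the Fock state is an eigenfunction, F ψ_n = (-i)^n ψ_n (`fourierSchwartz_fock`),
because the Gaussian is fixed by F and F commutes with the raising operator up to the factor -i.

The state left by outcome n encodes the vector v with v_b = ⟨n|b_L⟩ (`encoder_amplitude`). Pairing
the Poisson identity with ψ_n gives v = c H v, where c = (-i)^n. When c² = 1 this says H v = c v,
and then F s_n = F(enc v) = enc(H v) = c s_n. For n ≡ 0, 2 mod 4 the value of c is 1, -1. -/

/-- Precomposition of a Schwartz function with the dilation `x ↦ a * x`. -/
noncomputable def dilate (a : ℝ) (ha : a ≠ 0) : 𝓢(ℝ, ℂ) →L[ℂ] 𝓢(ℝ, ℂ) :=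
  SchwartzMap.compCLMOfContinuousLinearEquiv ℂ
    (ContinuousLinearEquiv.smulLeft (Units.mk0 a ha : ℝˣ))

theorem dilate_apply (a : ℝ) (ha : a ≠ 0) (φ : 𝓢(ℝ, ℂ)) (x : ℝ) :
    dilate a ha φ x = φ (a * x) := rfl

theorem fourierSchwartz_eq_fourier (φ : 𝓢(ℝ, ℂ)) (p : ℝ) :
    fourierSchwartz φ p = ((Real.sqrt (2 * Real.pi) : ℝ) : ℂ)⁻¹ *
      𝓕 (φ : ℝ → ℂ) ((2 * Real.pi)⁻¹ * p) := rfl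

theorem summable_int_schwartz (φ : 𝓢(ℝ, ℂ)) : Summable fun k : ℤ => φ (k : ℝ) :=
  summable_of_isBigO (Real.summable_abs_int_rpow one_lt_two)
    ((φ.isBigO_cocompact_rpow (-2)).comp_tendsto Int.tendsto_coe_cofinite)

theorem tsum_int_even_add_odd {f : ℤ → ℂ} (hf : Summable f) :
    ∑' k : ℤ, f k = ∑' k : ℤ, f (2 * k) + ∑' k : ℤ, f (2 * k + 1) := by
  have h0 : Function.Injective fun k : ℤ => 2 * k := fun a b h => by simpa using h
  have h1 : Function.Injective fun k : ℤ => 2 * k + 1 := fun a b h => by simpa using h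
  have he := h0.hasSum_range_iff.2 (hf.comp_injective h0).hasSum
  have ho := h1.hasSum_range_iff.2 (hf.comp_injective h1).hasSum
  refine (HasSum.add_isCompl ?_ he ho).tsum_eq
  have e0 : (Set.range fun k : ℤ => 2 * k) = {k | Even k} :=
    Set.ext fun k => ⟨fun ⟨m, hm⟩ => even_iff_exists_two_mul.2 ⟨m, hm.symm⟩,
      fun hk => (even_iff_exists_two_mul.1 hk).imp fun _ h => h.symm⟩
  have e1 : (Set.range fun k : ℤ => 2 * k + 1) = {k | Odd k} :=
    Set.ext fun k => ⟨fun ⟨m, hm⟩ => ⟨m, hm.symm⟩, fun ⟨m, hm⟩ => ⟨m, hm.symm⟩⟩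
  rw [e0, e1]
  exact Int.isCompl_even_odd

theorem fourier_dilate (a : ℝ) (ha : 0 < a) (φ : 𝓢(ℝ, ℂ)) (w : ℝ) :
    𝓕 (dilate a ha.ne' φ) w = (a : ℂ)⁻¹ * 𝓕 φ (a⁻¹ * w) := by
  have h : 𝓕 (dilate a ha.ne' φ) w = 𝓕 (fun x => φ (a * x)) w := rfl
  rw [h, SchwartzMap.fourier_coe φ, Real.fourier_real_eq, Real.fourier_real_eq]
  have := Measure.integral_comp_mul_left (fun y : ℝ => Real.fourierChar (-(y * (a⁻¹ * w))) • φ y) a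
  rw [abs_of_pos (inv_pos.2 ha)] at this
  simp only [Complex.real_smul, Complex.ofReal_inv] at this
  rw [← this]
  refine integral_congr_ae (Filter.Eventually.of_forall fun x => ?_)
  have : a * x * (a⁻¹ * w) = x * w := by field_simp
  simp only [this]

/-- `|b_L⟩ = 2^(-1/2) F (|0_L⟩ + (-1)^b |1_L⟩)`. -/
theorem logicalKet_eq_fourierSchwartz (b : Fin 2) (φ : 𝓢(ℝ, ℂ)) :
    logicalKet b φ = ((Real.sqrt 2 : ℝ) : ℂ)⁻¹ *
      (logicalKet 0 (fourierSchwartz φ) + (-1) ^ (b : ℕ) * logicalKet 1 (fourierSchwartz φ)) := by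
  have hpi : 0 < Real.sqrt Real.pi := Real.sqrt_pos.2 Real.pi_pos
  have ha : 0 < 2 * Real.sqrt Real.pi := by positivity
  -- Each comb has period 2√π. Dilating by it turns the comb into a translate of ℤ by b/2, since
  -- 2√π(b/2 + k) = (2k + b)√π.
  have hP := SchwartzMap.tsum_eq_tsum_fourier (dilate _ ha.ne' φ) ((b : ℕ) / 2)
  have hL : logicalKet b φ =
      ∑' n : ℤ, dilate _ ha.ne' φ (((b : ℕ) : ℝ) / 2 + n) := by
    rw [logicalKet_apply]
    refine tsum_congr fun k => ?_
    rw [dilate_apply]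
    congr 1
    ring
  -- In the unitary convention the dual lattice has spacing 2π/(2√π) = √π, so it contains the points
  -- of both combs. The constant is √(2π)/(2√π) = 1/√2.
  have hF (n : ℤ) : 𝓕 (dilate _ ha.ne' φ) (n : ℝ) =
      ((Real.sqrt 2 : ℝ) : ℂ)⁻¹ * fourierSchwartz φ (n * Real.sqrt Real.pi) := by
    rw [fourier_dilate _ ha, fourierSchwartz_eq_fourier, SchwartzMap.fourier_coe]
    have e1 : (2 * Real.pi)⁻¹ * (n * Real.sqrt Real.pi) = (2 * Real.sqrt Real.pi)⁻¹ * n := by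
      have := Real.mul_self_sqrt Real.pi_pos.le
      field_simp
      linear_combination n * this
    rw [e1, ← mul_assoc]
    congr 1
    have h2 := Real.mul_self_sqrt (zero_le_two (α := ℝ))
    rw [Real.sqrt_mul zero_le_two, ← mul_inv, ← Complex.ofReal_mul, ← mul_assoc, h2]
  -- The shift by b/2 becomes the phase e^(πibn): trivial for even n, (-1)^b for odd n. This is the
  -- sign pattern of the Hadamard matrix.
  have hC (n : ℤ) : fourier n ((((b : ℕ) : ℝ) / 2 : ℝ) : UnitAddCircle) =
      ((-1 : ℂ) ^ (b : ℕ)) ^ n := by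
    rw [fourier_coe_apply, ← Complex.exp_pi_mul_I, ← Complex.exp_nat_mul, ← Complex.exp_int_mul]
    congr 1
    push_cast
    ring
  have hs : Summable fun n : ℤ => fourierSchwartz φ (n * Real.sqrt Real.pi) := by
    simpa [dilate_apply, mul_comm] using
      summable_int_schwartz (dilate _ hpi.ne' (fourierSchwartz φ))
  have hs' : Summable fun n : ℤ =>
      fourierSchwartz φ (n * Real.sqrt Real.pi) * ((-1 : ℂ) ^ (b : ℕ)) ^ n := by
    refine Summable.of_norm ?_
    simpa using hs.norm
  rw [hL, hP]
  simp only [hF, hC, mul_assoc]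
  -- Even multiples of √π make up |0_L⟩, odd multiples |1_L⟩.
  rw [tsum_mul_left, tsum_int_even_add_odd hs', logicalKet_apply, logicalKet_apply, ← tsum_mul_left]
  have hsq : ((-1 : ℂ) ^ (b : ℕ)) ^ 2 = 1 := by rw [← pow_mul, mul_comm, pow_mul]; simp
  have hne : ((-1 : ℂ) ^ (b : ℕ)) ≠ 0 := by simp
  congr 2
  · refine tsum_congr fun k => ?_
    rw [zpow_mul, zpow_ofNat, hsq, one_zpow]
    simp
  · refine tsum_congr fun k => ?_
    rw [zpow_add₀ hne, zpow_mul, zpow_ofNat, hsq, one_zpow]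
    simp [mul_comm]

/-! ### Fock states are eigenvectors of the Fourier transform -/

/-- Differentiating the three-term recurrence involves the derivatives of the two preceding
polynomials, hence the strong induction. The identity serves to trade the recurrence for the raising
form `hermitePoly_succ`. -/
theorem derivative_hermitePoly (n : ℕ) : Polynomial.derivative (hermitePoly (n + 1)) =
    2 * ((n : Polynomial ℝ) + 1) * hermitePoly n := by
  induction n using Nat.strong_induction_on with
  | _ n ih =>
    match n with
    | 0 => simp [hermitePoly]
    | 1 =>
      have h := ih 0 (by norm_num)
      simp only [hermitePoly] at h ⊢
      simp
      ring
    | n + 2 =>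
      have h1 := ih (n + 1) (by omega)
      have h0 := ih n (by omega)
      rw [hermitePoly, Polynomial.derivative_sub, Polynomial.derivative_mul,
        Polynomial.derivative_mul, Polynomial.derivative_mul, Polynomial.derivative_mul, h1, h0]
      rw [hermitePoly]
      simp
      ring

theorem hermitePoly_succ (n : ℕ) : hermitePoly (n + 1) =
    2 * Polynomial.X * hermitePoly n - Polynomial.derivative (hermitePoly n) := by
  cases n with
  | zero => simp [hermitePoly]
  | succ n => rw [derivative_hermitePoly, hermitePoly]

/-- A real polynomial times the Gaussian `e^(-x²/2)`, as a complex-valued function. -/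
noncomputable def polyGauss (p : Polynomial ℝ) (x : ℝ) : ℂ :=
  ((p.eval x * Real.exp (-(x ^ 2 / 2)) : ℝ) : ℂ)

theorem hasDerivAt_polyGauss (p : Polynomial ℝ) (x : ℝ) :
    HasDerivAt (polyGauss p) (polyGauss (Polynomial.derivative p - Polynomial.X * p) x) x := by
  have h2 : HasDerivAt (fun x : ℝ => -(x ^ 2 / 2)) (-x) x := by
    refine ((hasDerivAt_pow 2 x).div_const 2).neg.congr_deriv ?_
    simp
  refine (((p.hasDerivAt x).mul h2.exp).congr_deriv ?_).ofReal_comp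
  simp only [Polynomial.eval_sub, Polynomial.eval_mul, Polynomial.eval_X]
  ring

theorem integrable_polyGauss (p : Polynomial ℝ) : Integrable (polyGauss p) := by
  -- The extra factor 1 + x² supplies the integrable majorant C/(1 + x²).
  obtain ⟨C, hC⟩ := bounded_poly_mul_gaussian ((1 + Polynomial.X ^ 2) * p)
  refine Integrable.mono' (integrable_inv_one_add_sq.const_mul C) ?_
    (Filter.Eventually.of_forall fun x => ?_)
  · unfold polyGauss
    exact Continuous.aestronglyMeasurable (by fun_prop)
  · have h := hC x
    have hx : 0 < 1 + x ^ 2 := by positivity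
    rw [Polynomial.eval_mul, mul_assoc, abs_mul] at h
    simp only [Polynomial.eval_add, Polynomial.eval_one, Polynomial.eval_pow,
      Polynomial.eval_X, abs_of_pos hx] at h
    rw [polyGauss, Complex.norm_real, Real.norm_eq_abs, ← div_eq_mul_inv, le_div_iff₀ hx, mul_comm]
    exact h

theorem fourier_polyGauss_one (w : ℝ) : 𝓕 (polyGauss 1) w =
    ((Real.sqrt (2 * Real.pi) : ℝ) : ℂ) * polyGauss 1 (2 * Real.pi * w) := by
  have hpi : (Real.pi : ℂ) ≠ 0 := by exact_mod_cast Real.pi_ne_zero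
  -- With b = 1/2 and frequency t = -2πw, the formula (π/b)^(1/2) e^(-t²/(4b)) is √(2π)
  -- e^(-(2πw)²/2).
  have h := fourierIntegral_gaussian (b := 1 / 2) (by norm_num) (-(2 * Real.pi * w) : ℂ)
  rw [Real.fourier_eq']
  convert h using 1
  · refine integral_congr_ae (Filter.Eventually.of_forall fun x => ?_)
    simp [polyGauss]
    congr 2 <;> ring
  · rw [Real.sqrt_eq_rpow, Complex.ofReal_cpow Real.two_pi_pos.le]
    simp [polyGauss]
    congr 2 <;> ring

theorem polyGauss_X_mul (p : Polynomial ℝ) (x : ℝ) :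
    polyGauss (Polynomial.X * p) x = x * polyGauss p x := by
  simp [polyGauss, mul_assoc]

theorem polyGauss_sub (p q : Polynomial ℝ) (x : ℝ) :
    polyGauss (p - q) x = polyGauss p x - polyGauss q x := by
  simp [polyGauss, sub_mul]

theorem fourier_polyGauss_sub (p q : Polynomial ℝ) (w : ℝ) :
    𝓕 (polyGauss (p - q)) w = 𝓕 (polyGauss p) w - 𝓕 (polyGauss q) w := by
  rw [Real.fourier_real_eq, Real.fourier_real_eq, Real.fourier_real_eq, ← integral_sub]
  · simp only [polyGauss_sub, smul_sub]
  · simpa [mul_comm] using (Real.fourierIntegral_convergent_iff w).2 (integrable_polyGauss p)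
  · simpa [mul_comm] using (Real.fourierIntegral_convergent_iff w).2 (integrable_polyGauss q)

theorem fourier_polyGauss_derivative (p : Polynomial ℝ) (w : ℝ) :
    𝓕 (polyGauss (Polynomial.derivative p - Polynomial.X * p)) w =
      2 * Real.pi * Complex.I * w * 𝓕 (polyGauss p) w := by
  have hd : deriv (polyGauss p) = polyGauss (Polynomial.derivative p - Polynomial.X * p) :=
    funext fun x => (hasDerivAt_polyGauss p x).deriv
  have hdi : Integrable (deriv (polyGauss p)) := by
    rw [hd]
    exact integrable_polyGauss _
  have hdiff : Differentiable ℝ (polyGauss p) :=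
    fun x => (hasDerivAt_polyGauss p x).differentiableAt
  rw [← hd, Real.fourier_deriv (integrable_polyGauss p) hdiff hdi]
  simp only [smul_eq_mul]

theorem deriv_fourier_polyGauss (p : Polynomial ℝ) (w : ℝ) :
    deriv (𝓕 (polyGauss p)) w =
      -2 * Real.pi * Complex.I * 𝓕 (polyGauss (Polynomial.X * p)) w := by
  have hXi : Integrable fun x : ℝ => x • polyGauss p x := by
    refine (integrable_polyGauss (Polynomial.X * p)).congr
      (Filter.Eventually.of_forall fun x => ?_)
    simp [polyGauss_X_mul]
  rw [Real.deriv_fourier (integrable_polyGauss p) hXi, Real.fourier_real_eq,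
    Real.fourier_real_eq, ← integral_const_mul]
  refine integral_congr_ae (Filter.Eventually.of_forall fun x => ?_)
  simp only [polyGauss_X_mul, Circle.smul_def, smul_eq_mul]
  ring

/-- Times the Gaussian, H_{n+1} arises from H_n by the raising operator x - d/dx. The Fourier
transform exchanges multiplication and differentiation, so it carries this operator to -i times
itself, and each step contributes one factor -i. The argument 2πw and the factor √(2π) translate
between the two Fourier conventions. -/
theorem fourier_polyGauss_hermitePoly (n : ℕ) (w : ℝ) : 𝓕 (polyGauss (hermitePoly n)) w =
    ((Real.sqrt (2 * Real.pi) : ℝ) : ℂ) * (-Complex.I) ^ n *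
      polyGauss (hermitePoly n) (2 * Real.pi * w) := by
  induction n generalizing w with
  | zero => simpa [hermitePoly] using fourier_polyGauss_one w
  | succ n ih =>
    have hpi : (Real.pi : ℂ) ≠ 0 := by exact_mod_cast Real.pi_ne_zero
    -- The bracket is the polynomial factor of the derivative of H_n e^(-x²/2), so the right side is
    -- x - d/dx applied to that function.
    have hsucc : hermitePoly (n + 1) = Polynomial.X * hermitePoly n -
        (Polynomial.derivative (hermitePoly n) - Polynomial.X * hermitePoly n) := by
      rw [hermitePoly_succ]
      ring
    have hX : 𝓕 (polyGauss (Polynomial.X * hermitePoly n)) w =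
        Complex.I * (((Real.sqrt (2 * Real.pi) : ℝ) : ℂ) * (-Complex.I) ^ n) *
          polyGauss (Polynomial.derivative (hermitePoly n) - Polynomial.X * hermitePoly n)
            (2 * Real.pi * w) := by
      have h := deriv_fourier_polyGauss (hermitePoly n) w
      have hd := ((hasDerivAt_polyGauss (hermitePoly n) (2 * Real.pi * w)).scomp w
        ((hasDerivAt_id w).const_mul (2 * Real.pi))).const_mul
          (((Real.sqrt (2 * Real.pi) : ℝ) : ℂ) * (-Complex.I) ^ n)
      -- The induction hypothesis holds for all frequencies, so it may be differentiated in w; this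
      -- yields the transform of x H_n e^(-x²/2).
      rw [funext ih] at h
      have h' := hd.deriv.symm.trans h
      rw [mul_one, Complex.real_smul] at h'
      push_cast at h'
      have hne : (-2 * Real.pi * Complex.I : ℂ) ≠ 0 := by simp [hpi]
      refine mul_left_cancel₀ hne (h'.symm.trans ?_)
      linear_combination (2 * Real.pi * (((Real.sqrt (2 * Real.pi) : ℝ) : ℂ) * (-Complex.I) ^ n) *
        polyGauss (Polynomial.derivative (hermitePoly n) - Polynomial.X * hermitePoly n)
          (2 * Real.pi * w)) * Complex.I_sq
    rw [hsucc, fourier_polyGauss_sub, fourier_polyGauss_derivative, hX, ih, pow_succ]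
    simp only [polyGauss_sub, polyGauss_X_mul]
    push_cast
    ring

theorem fock_eq_polyGauss (n : ℕ) (x : ℝ) : fock n x =
    ((Real.sqrt (2 ^ n * n.factorial * Real.sqrt Real.pi))⁻¹ : ℝ) *
      polyGauss (hermitePoly n) x := by
  rw [fock_apply, hermiteFun, polyGauss, mul_assoc, Complex.ofReal_mul]

/-- The Fock state `|n⟩` is an eigenvector of the unitary Fourier transform. -/
theorem fourierSchwartz_fock (n : ℕ) : fourierSchwartz (fock n) = (-Complex.I) ^ n • fock n := by
  ext p
  have h2 : ((Real.sqrt (2 * Real.pi) : ℝ) : ℂ) ≠ 0 := by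
    exact_mod_cast (Real.sqrt_pos.2 Real.two_pi_pos).ne'
  have hf : (fock n : ℝ → ℂ) =
      ((((Real.sqrt (2 ^ n * n.factorial * Real.sqrt Real.pi))⁻¹ : ℝ) : ℂ)) •
        polyGauss (hermitePoly n) := funext (fock_eq_polyGauss n)
  have hF : 𝓕 (fock n : ℝ → ℂ) ((2 * Real.pi)⁻¹ * p) =
      (((Real.sqrt (2 ^ n * n.factorial * Real.sqrt Real.pi))⁻¹ : ℝ) : ℂ) *
        𝓕 (polyGauss (hermitePoly n)) ((2 * Real.pi)⁻¹ * p) := by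
    rw [hf, Real.fourier_real_eq, Real.fourier_real_eq, ← integral_const_mul]
    refine integral_congr_ae (Filter.Eventually.of_forall fun x => ?_)
    simp only [Pi.smul_apply, Circle.smul_def, smul_eq_mul]
    ring
  rw [fourierSchwartz_eq_fourier, hF, fourier_polyGauss_hermitePoly,
    mul_inv_cancel_left₀ Real.two_pi_pos.ne', smul_apply, fock_eq_polyGauss,
    smul_eq_mul]
  field_simp

/-! ### The distilled state -/

/-- The logical qubit state of the distilled state, with amplitudes `⟨n|b_L⟩`. -/
noncomputable def amplitude (n : ℕ) : Fin 2 → ℂ := fun b => logicalKet b (fock n)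

theorem encoder_apply (v : Fin 2 → ℂ) (φ : 𝓢(ℝ, ℂ)) :
    encoder v φ = v 0 * logicalKet 0 φ + v 1 * logicalKet 1 φ := by
  simp only [encoder, Fintype.linearCombination_apply, Fin.sum_univ_two]
  rfl

theorem hadamard_apply (v : Fin 2 → ℂ) (b : Fin 2) :
    hadamard v b = ((Real.sqrt 2 : ℝ) : ℂ)⁻¹ * (v 0 + (-1) ^ (b : ℕ) * v 1) := by
  fin_cases b <;>
    simp [hadamard, Matrix.toLin'_apply, Matrix.mulVec, dotProduct, Fin.sum_univ_two] <;> ring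

/-- On product test functions the entangled state splits as a sum over b of products, and its first
factor at ψ_n is ⟨n|b_L⟩. -/
theorem encoder_amplitude (n : ℕ) : encoder (amplitude n) = distilled n := by
  ext φ
  rw [encoder_apply, distilled, contractFirst_apply, bellState_tensor, Fin.sum_univ_two]
  rfl

/-- Poisson summation gives enc w = F(enc(H w)); the involution turns this into F(enc v) = enc(H v),
by taking w = H v. -/
theorem hadamard_hadamard (v : Fin 2 → ℂ) : hadamard (hadamard v) = v := by
  have h2 : ((Real.sqrt 2 : ℝ) : ℂ) ^ 2 = 2 := by
    exact_mod_cast Real.sq_sqrt (zero_le_two (α := ℝ))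
  have h0 : ((Real.sqrt 2 : ℝ) : ℂ) ≠ 0 := by
    exact_mod_cast (Real.sqrt_pos.2 (zero_lt_two (α := ℝ))).ne'
  funext b
  rw [hadamard_apply, hadamard_apply, hadamard_apply]
  fin_cases b <;> simp <;> field_simp <;> rw [h2] <;> ring

/-- The Fourier gate implements the logical Hadamard gate on the GKP code. -/
theorem fourierGate_encoder (v : Fin 2 → ℂ) :
    fourierGate (encoder v) = encoder (hadamard v) := by
  ext φ
  have h (w : Fin 2 → ℂ) : encoder w φ = encoder (hadamard w) (fourierSchwartz φ) := by
    rw [encoder_apply, encoder_apply, logicalKet_eq_fourierSchwartz 0 φ,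
      logicalKet_eq_fourierSchwartz 1 φ, hadamard_apply, hadamard_apply]
    simp
    ring
  rw [fourierGate_apply, h (hadamard v), hadamard_hadamard]

/-- Evaluating the Poisson identity at ψ_n, where F acts as the scalar c, gives v = c H v.
Multiplying by c and using c² = 1 gives H v = c v. -/
theorem hadamard_amplitude (n : ℕ) {c : ℂ} (hc : (-Complex.I) ^ n = c) (hcc : c * c = 1) :
    hadamard (amplitude n) = c • amplitude n := by
  funext b
  have h := logicalKet_eq_fourierSchwartz b (fock n)
  rw [fourierSchwartz_fock, hc, map_smul, map_smul] at h
  rw [hadamard_apply, Pi.smul_apply]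
  simp only [amplitude, smul_eq_mul] at h ⊢
  rw [h]
  linear_combination -(((Real.sqrt 2 : ℝ) : ℂ)⁻¹ *
    (logicalKet 0 (fock n) + (-1) ^ (b : ℕ) * logicalKet 1 (fock n))) * hcc

theorem isHadamardEigenstate_distilled {n : ℕ} {c : ℂ} (hc : (-Complex.I) ^ n = c)
    (hcc : c * c = 1) (hocc : distilled n ≠ 0) : IsHadamardEigenstate c (distilled n) := by
  have h := hadamard_amplitude n hc hcc
  refine ⟨hocc, ⟨amplitude n, encoder_amplitude n, h⟩, ?_⟩
  rw [← encoder_amplitude, fourierGate_encoder, h, map_smul]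

theorem neg_I_pow_mod_four (n : ℕ) : (-Complex.I) ^ n = (-Complex.I) ^ (n % 4) := by
  have h4 : (-Complex.I) ^ 4 = 1 := by rw [Even.neg_pow (by decide), Complex.I_pow_four]
  conv_lhs => rw [← Nat.div_add_mod n 4, pow_add, pow_mul, h4, one_pow, one_mul]

end GKP

theorem mainTheorem8 (n : ℕ) (hn : Even n) (hocc : GKP.distilled n ≠ 0) :
    (n ≡ 0 [MOD 4] → GKP.IsHadamardEigenstate 1 (GKP.distilled n)) ∧
      (n ≡ 2 [MOD 4] → GKP.IsHadamardEigenstate (-1) (GKP.distilled n)) := by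
  constructor
  · intro h
    refine GKP.isHadamardEigenstate_distilled ?_ (by norm_num) hocc
    rw [GKP.neg_I_pow_mod_four, show n % 4 = 0 from h, pow_zero]
  · intro h
    refine GKP.isHadamardEigenstate_distilled ?_ (by norm_num) hocc
    rw [GKP.neg_I_pow_mod_four, show n % 4 = 2 from h, neg_sq, Complex.I_sq]
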